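/- Let $(G,S)$ be a Garside system with $S=\mathrm{Div}(\Delta)$: $G$ is a group, the submonoid $G^+$ generated by $S$ is Noetherian, cancellative, and has left and right lcm's, $G$ is its group of fractions, and $S$ is finite, generates $G$, and is both the set of left divisors and the set of right divisors of $\Delta\in G^+$. Write $a\preceq b$ if $a^{-1}b\in G^+$, let $\wedge$ and $\tilde\wedge$ be the left and right gcd in $G^+$, $\tau(a)=\Delta^{-1}a\Delta$, and $\partial(a)=a^{-1}\Delta$ for $a\in S$. Assume that the system is of spindle type: $a\wedge b$ and $a\,\tilde\wedge\,b$ lie in $\{a,b,1\}$ for all $a,b\in S$. For $b\in G$ let $\inf(b)$ be the largest $r\in\mathbb Z$ with $\Delta^r\preceq b$ and $\sup(b)$ the smallest $r\in\mathbb Z$ with $b\preceq\Delta^r$; let $\inf_s(b)$ be the maximum of $\inf$, and $\sup_s(b)$ the minimum of $\sup$, over the conjugacy class of $b$; and let $SSS(b)$ be the set of conjugates $x$ of $b$ with $\Delta^{\inf_s(b)}\preceq x\preceq\Delta^{\sup_s(b)}$. Let $b=\Delta^p s_1\cdots s_l$ be in left normal form, i.e. $p=\inf(b)$, $s_i=\Delta\wedge(s_i\cdots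 s_l)$ for all $i$, and $s_l\neq 1$. The decycling of $b$ is $d(b)=\Delta^p\,\tau^p(s_l)\,s_1\cdots s_{l-1}$ (and $d(b)=b$ if $l=0$). The element $b$ is rigid if $\tau^{-p}(s_1)\wedge\partial(s_l)=1$; powers of $\Delta$ (the case $l=0$) count as rigid. Let $b=\Delta^p s_1\cdots s_l$ (left normal form) be non-rigid. (1) If $\tau^p(s_l)s_1\neq\Delta$, then $d(b)\in SSS(b)$. (2) Suppose $\inf_s(b)=p+p_0$. Then $2p_0\le l$, and for $1\le k\le p_0$ $$d^k(b)=\begin{cases}\Delta^{p+k}s_{k+1}\cdots s_{l-k}, & k<p_0,\\ \Delta^{p+p_0}s_{p_0}''\,s_{p_0+1}\cdots s_{l-p_0}, & k=p_0,\end{cases}$$ where, for $p_0\ge1$, $s_{p_0}=s_{p_0}'s_{p_0}''$ with $s_{p_0}',s_{p_0}''\in S$, $s_{p_0}'=s_{p_0}\wedge\tau^{p+p_0-1}(\partial(s_{l-p_0+1}))$, and $\tau^{p+p_0-1}(s_{l-p_0+1})\,s_{p_0}=\Delta s_{p_0}''$. -/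

import Mathlib

namespace Garside

/-- `m` is a right lcm of `a` and `b` in the monoid `M`, i.e. a least common right multiple.
Mathlib's `a ∣ b` means `∃ c, b = a * c`, that is, `a` is a left divisor of `b`. -/
def IsRightLcm {M : Type*} [Monoid M] (a b m : M) : Prop :=
  a ∣ m ∧ b ∣ m ∧ ∀ c, a ∣ c → b ∣ c → m ∣ c

/-- `a` is a right divisor of `b`. -/
def IsRightDvd {M : Type*} [Monoid M] (a b : M) : Prop :=
  ∃ c, b = c * a

/-- `m` is a left lcm of `a` and `b`, i.e. a least common left multiple. -/
def IsLeftLcm {M : Type*} [Monoid M] (a b m : M) : Prop :=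
  IsRightDvd a m ∧ IsRightDvd b m ∧ ∀ c, IsRightDvd a c → IsRightDvd b c → IsRightDvd m c

/-- Lcm monoids: Noetherian (atomic), cancellative, with right and left lcms of all pairs. -/
structure IsLcmMonoid (M : Type*) [Monoid M] : Prop where
  noetherian : ∀ a : M, ∃ n : ℕ, ∀ L : List M, (∀ x ∈ L, x ≠ 1) → L.prod = a → L.length ≤ n
  cancel : ∀ a b b' c : M, a * b * c = a * b' * c → b = b'
  rightLcm : ∀ a b : M, ∃ m, IsRightLcm a b m
  leftLcm : ∀ a b : M, ∃ m, IsLeftLcm a b m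

variable {G : Type*} [Group G]

/-- The submonoid `G⁺` of `G` generated by `S`. -/
abbrev pos (S : Set G) : Submonoid G := Submonoid.closure S

/-- The prefix order `a ≼ b` on `G`: there is `c ∈ P` with `b = a * c`. -/
def LeftDiv (P : Submonoid G) (a b : G) : Prop := ∃ c ∈ P, b = a * c

/-- The suffix order on `G` (`a` is a right divisor of `b`): there is `c ∈ P` with `b = c * a`. -/
def RightDiv (P : Submonoid G) (a b : G) : Prop := ∃ c ∈ P, b = c * a

/-- `d = a ∧ b`, the left gcd, in the monoid `P`, of elements `a`, `b` of `P`. -/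
def IsLeftGcd (P : Submonoid G) (a b d : G) : Prop :=
  d ∈ P ∧ LeftDiv P d a ∧ LeftDiv P d b ∧
    ∀ c ∈ P, LeftDiv P c a → LeftDiv P c b → LeftDiv P c d

/-- `d` is the right gcd, in the monoid `P`, of elements `a`, `b` of `P`. -/
def IsRightGcd (P : Submonoid G) (a b d : G) : Prop :=
  d ∈ P ∧ RightDiv P d a ∧ RightDiv P d b ∧
    ∀ c ∈ P, RightDiv P c a → RightDiv P c b → RightDiv P c d

/-- `(G, S)` is a Garside system with `S = Div(Δ)`. -/
structure IsGarsideSystem (S : Set G) (Δ : G) : Prop where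
  lcmMonoid : IsLcmMonoid (pos S)
  /-- `G` is the group of (left and right) fractions of `G⁺`. -/
  leftFrac : ∀ g : G, ∃ a ∈ pos S, ∃ b ∈ pos S, g = a⁻¹ * b
  rightFrac : ∀ g : G, ∃ a ∈ pos S, ∃ b ∈ pos S, g = a * b⁻¹
  delta_mem : Δ ∈ pos S
  /-- `Δ` is balanced: `S` is the set of left divisors and the set of right divisors of `Δ`. -/
  mem_iff_left : ∀ a : G, a ∈ S ↔ a ∈ pos S ∧ LeftDiv (pos S) a Δ
  mem_iff_right : ∀ a : G, a ∈ S ↔ a ∈ pos S ∧ RightDiv (pos S) a Δ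
  finite : S.Finite
  generates : Subgroup.closure S = ⊤

/-- A Garside system of spindle type: for all simple `a`, `b`, both the left gcd and the
right gcd of `a` and `b` lie in `{a, b, 1}`. -/
structure IsSpindleType (S : Set G) (Δ : G) : Prop extends IsGarsideSystem S Δ where
  leftGcd : ∀ a ∈ S, ∀ b ∈ S, ∃ d ∈ ({a, b, 1} : Set G), IsLeftGcd (pos S) a b d
  rightGcd : ∀ a ∈ S, ∀ b ∈ S, ∃ d ∈ ({a, b, 1} : Set G), IsRightGcd (pos S) a b d

/-- The inner automorphism `τ : a ↦ Δ⁻¹ a Δ`; `τ Δ ^ p` is its `p`-th power, `p : ℤ`. -/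
def τ (Δ : G) : MulAut G := MulAut.conj Δ⁻¹

/-- `∂ a = a \ Δ` for simple `a`: there `a ∨ Δ = Δ`, so `a * ∂ a = Δ`. -/
def rightCompl (Δ a : G) : G := a⁻¹ * Δ

/-- `r = inf(b)`: the maximal integer `r` with `Δ ^ r ≼ b`. -/
def IsInf (S : Set G) (Δ b : G) (r : ℤ) : Prop :=
  IsGreatest {n : ℤ | LeftDiv (pos S) (Δ ^ n) b} r

/-- `r = sup(b)`: the minimal integer `r` with `b ≼ Δ ^ r`. -/
def IsSup (S : Set G) (Δ b : G) (r : ℤ) : Prop :=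
  IsLeast {n : ℤ | LeftDiv (pos S) b (Δ ^ n)} r

/-- The summit infimum: the maximal value of `inf` in the conjugacy class of `b`. -/
def IsSummitInf (S : Set G) (Δ b : G) (r : ℤ) : Prop :=
  IsGreatest {n : ℤ | ∃ b' : G, IsConj b b' ∧ IsInf S Δ b' n} r

/-- The summit supremum: the minimal value of `sup` in the conjugacy class of `b`. -/
def IsSummitSup (S : Set G) (Δ b : G) (r : ℤ) : Prop :=
  IsLeast {n : ℤ | ∃ b' : G, IsConj b b' ∧ IsSup S Δ b' n} r

/-- The super summit set `SSS(b)`: the conjugates `x` of `b` with `Δ ^ inf_s(b) ≼ x ≼ Δ ^ sup_s(b)`. -/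
def SSS (S : Set G) (Δ b : G) : Set G :=
  {x | IsConj b x ∧ ∃ m M : ℤ, IsSummitInf S Δ b m ∧ IsSummitSup S Δ b M ∧
    LeftDiv (pos S) (Δ ^ m) x ∧ LeftDiv (pos S) x (Δ ^ M)}

/-- The factor `s_i` of `s = [s_1, …, s_l]` (indices start at `1`). -/
def factor (s : List G) (i : ℕ) : G := s.getD (i - 1) 1

/-- The product `s_i s_{i+1} ⋯ s_j` for `s = [s_1, …, s_l]` and `1 ≤ i`, `j ≤ l`
(equal to `1` if `j < i`). -/
def seg (s : List G) (i j : ℕ) : G := ((s.take j).drop (i - 1)).prod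

/-- `b = Δ ^ p * s_1 ⋯ s_l` is the left (`Δ`-)normal form of `b`: `p = inf(b)`,
`s_i = Δ ∧ (s_i ⋯ s_l)` for every `i`, and `s_l ≠ 1`. -/
structure IsLNF (S : Set G) (Δ b : G) (p : ℤ) (s : List G) : Prop where
  isInf : IsInf S Δ b p
  eq : b = Δ ^ p * s.prod
  greedy : ∀ i, 1 ≤ i → i ≤ s.length →
    IsLeftGcd (pos S) Δ (seg s i s.length) (factor s i)
  last_ne : s ≠ [] → factor s s.length ≠ 1

/-- `b = Δ ^ p * s_1 ⋯ s_l` is rigid: `τ ^ (-p) (s_1) ∧ ∂ (s_l) = 1`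
(no condition if `l = 0`, i.e. if `b` is a power of `Δ`). -/
def IsRigid (S : Set G) (Δ b : G) : Prop :=
  ∀ (p : ℤ) (s : List G), IsLNF S Δ b p s → s ≠ [] →
    IsLeftGcd (pos S) ((τ Δ ^ (-p)) (factor s 1)) (rightCompl Δ (factor s s.length)) 1

open Classical in
/-- The decycling `d(b) = Δ ^ p * τ ^ p (s_l) * s_1 ⋯ s_{l-1}`, where `Δ ^ p * s_1 ⋯ s_l` is the left
normal form of `b` (so `d(b) = b` if `l = 0`). In a Garside system with `Δ ≠ 1` every element has a
unique left normal form; the default value `b` is then not used. -/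
noncomputable def decycling (S : Set G) (Δ b : G) : G :=
  if h : ∃ q : ℤ × List G, IsLNF S Δ b q.1 q.2 then
    Δ ^ h.choose.1 * (τ Δ ^ h.choose.1) (factor h.choose.2 h.choose.2.length) *
      seg h.choose.2 1 (h.choose.2.length - 1)
  else b

end Garside

/-!
In spindle type, the divisors of a simple element other than `Δ` form a chain. Let
`b = Δ ^ p * s_1 ⋯ s_l` be a left normal form and `t = τ ^ p (s_l)`, so that decycling produces
`Δ ^ p * t * s_1 ⋯ s_{l-1}`. Non-rigidity says that the pair `(t, s_1)` is not left-weighted, and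
then `s_1` and `∂ t` are comparable: either `t * s_1` is simple, or `t * s_1 = Δ * c` for a simple
element `c`.

If `t * s_1 ≠ Δ` and `l ≥ 2`, replacing `s_1` by `t * s_1`, respectively `c`, and deleting `s_l`
gives a word which is normal and, unless it is a single letter, stays normal around the cycle. The
normal forms of the powers of the element it represents are then concatenations of twists of this
word, so `inf` and `sup` are additive on these powers. As conjugation changes `inf` and `sup` by a
bounded amount, no conjugate can have larger `inf` or smaller `sup`: the element lies in the super
summit set. For words of one letter the same follows from Noetherianity.

If `t * s_1 = Δ`, decycling deletes both end letters and raises `inf` by one. While the infimum is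
below the summit infimum, the result is again not rigid, so the argument can be iterated.
-/

namespace Garside

variable {G : Type*} [Group G] {S : Set G} {Δ : G}

section LeftDiv

variable {P : Submonoid G} {a b c : G}

theorem leftDiv_iff : LeftDiv P a b ↔ a⁻¹ * b ∈ P :=
  ⟨by rintro ⟨c, hc, rfl⟩; simpa using hc, fun h => ⟨_, h, by group⟩⟩

theorem LeftDiv.refl (a : G) : LeftDiv P a a := ⟨1, P.one_mem, (mul_one a).symm⟩

theorem LeftDiv.trans (hab : LeftDiv P a b) (hbc : LeftDiv P b c) : LeftDiv P a c := by
  obtain ⟨x, hx, rfl⟩ := hab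
  obtain ⟨y, hy, rfl⟩ := hbc
  exact ⟨x * y, P.mul_mem hx hy, mul_assoc a x y⟩

theorem leftDiv_mul_right (a : G) (hb : b ∈ P) : LeftDiv P a (a * b) := ⟨b, hb, rfl⟩

theorem leftDiv_mul_left_iff : LeftDiv P (a * b) (a * c) ↔ LeftDiv P b c := by
  simp only [leftDiv_iff, mul_inv_rev, mul_assoc, inv_mul_cancel_left]

end LeftDiv

section Tau

theorem tau_zpow_apply (n : ℤ) (a : G) : (τ Δ ^ n) a = Δ ^ (-n) * a * Δ ^ n := by
  rw [τ, ← map_zpow, MulAut.conj_apply]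
  simp

theorem mul_zpow_eq_zpow_mul_tau (n : ℤ) (a : G) : a * Δ ^ n = Δ ^ n * (τ Δ ^ n) a := by
  rw [tau_zpow_apply]
  group

theorem tau_zpow_tau_zpow (m n : ℤ) (a : G) :
    (τ Δ ^ m) ((τ Δ ^ n) a) = (τ Δ ^ (m + n)) a := by
  rw [zpow_add, MulAut.mul_apply]

theorem tau_zpow_delta (n : ℤ) : (τ Δ ^ n) Δ = Δ := by
  rw [tau_zpow_apply]
  group

theorem mul_rightCompl (a : G) : a * rightCompl Δ a = Δ := mul_inv_cancel_left a Δ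

theorem eq_rightCompl_mul_of_mul_eq {a b c : G} (heq : a * b = Δ * c) : b = rightCompl Δ a * c := by
  rw [rightCompl, mul_assoc, ← heq, inv_mul_cancel_left]

theorem rightCompl_eq_one {a : G} : rightCompl Δ a = 1 ↔ a = Δ := inv_mul_eq_one

theorem rightCompl_eq_delta {a : G} : rightCompl Δ a = Δ ↔ a = 1 := by
  rw [rightCompl, mul_eq_right, inv_eq_one]

theorem rightCompl_rightCompl (a : G) : rightCompl Δ (rightCompl Δ a) = (τ Δ ^ (1 : ℤ)) a := by
  rw [rightCompl, rightCompl, tau_zpow_apply]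
  group

theorem tau_zpow_rightCompl (n : ℤ) (a : G) :
    (τ Δ ^ n) (rightCompl Δ a) = rightCompl Δ ((τ Δ ^ n) a) := by
  rw [rightCompl, rightCompl, map_mul, map_inv, tau_zpow_delta]

end Tau

/-- Quasi-Garside systems `(G, S)` with `S = Div(Δ)`: a balanced element `Δ` of a Noetherian
positive monoid `G⁺ = pos S` such that any two divisors of `Δ` have a right lcm and `G` is the group
of right fractions of `G⁺`. In contrast to a Garside system, `S` may be infinite. Elements of `G⁺`
are treated as elements of `G`. -/
structure IsQuasiGarsideSystem (S : Set G) (Δ : G) : Prop where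
  noetherian : ∀ a ∈ pos S, ∃ n : ℕ, ∀ L : List G,
    (∀ x ∈ L, x ∈ pos S ∧ x ≠ 1) → L.prod = a → L.length ≤ n
  rightLcm : ∀ a ∈ S, ∀ b ∈ S, ∃ m, LeftDiv (pos S) a m ∧ LeftDiv (pos S) b m ∧
    ∀ c, LeftDiv (pos S) a c → LeftDiv (pos S) b c → LeftDiv (pos S) m c
  rightFrac : ∀ g : G, ∃ a ∈ pos S, ∃ b ∈ pos S, g = a * b⁻¹
  delta_mem : Δ ∈ pos S
  mem_iff_left : ∀ a : G, a ∈ S ↔ a ∈ pos S ∧ LeftDiv (pos S) a Δ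
  mem_iff_right : ∀ a : G, a ∈ S ↔ a ∈ pos S ∧ RightDiv (pos S) a Δ

/-- Quasi-Garside systems of spindle type: the left divisors of every simple element other than
`Δ` form a chain. For a Garside system, passing to complements turns this into the condition that
the right gcd of any two simple elements `a`, `b` lies in `{a, b, 1}`. -/
structure IsQuasiSpindleType (S : Set G) (Δ : G) : Prop extends IsQuasiGarsideSystem S Δ where
  leftDiv_total : ∀ m ∈ S, m ≠ Δ → ∀ a ∈ pos S, ∀ b ∈ pos S,
    LeftDiv (pos S) a m → LeftDiv (pos S) b m → LeftDiv (pos S) a b ∨ LeftDiv (pos S) b a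

theorem IsGarsideSystem.isQuasiGarsideSystem (h : IsGarsideSystem S Δ) :
    IsQuasiGarsideSystem S Δ where
  noetherian a ha := by
    obtain ⟨n, hn⟩ := h.lcmMonoid.noetherian ⟨a, ha⟩
    refine ⟨n, fun L hL hprod => ?_⟩
    lift L to List (pos S) using fun x hx => (hL x hx).1
    rw [List.length_map]
    refine hn L (fun x hx h1 => ?_) (Subtype.ext ?_)
    · exact (hL x (List.mem_map_of_mem hx)).2 (by simp [h1])
    · rw [Submonoid.coe_list_prod]
      exact hprod
  rightLcm a ha b hb := by
    obtain ⟨m, ⟨x, hx⟩, ⟨y, hy⟩, hm⟩ := h.lcmMonoid.rightLcm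
      ⟨a, Submonoid.subset_closure ha⟩ ⟨b, Submonoid.subset_closure hb⟩
    refine ⟨m, ⟨x, x.2, congrArg Subtype.val hx⟩, ⟨y, y.2, congrArg Subtype.val hy⟩, ?_⟩
    rintro c ⟨u, hu, hau⟩ ⟨v, hv, hbv⟩
    have hc : c ∈ pos S := hau ▸ (pos S).mul_mem (Submonoid.subset_closure ha) hu
    obtain ⟨w, hw⟩ := hm ⟨c, hc⟩ ⟨⟨u, hu⟩, Subtype.ext hau⟩ ⟨⟨v, hv⟩, Subtype.ext hbv⟩
    exact ⟨w, w.2, congrArg Subtype.val hw⟩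
  rightFrac := h.rightFrac
  delta_mem := h.delta_mem
  mem_iff_left := h.mem_iff_left
  mem_iff_right := h.mem_iff_right

/-- The largest number of factors in a decomposition of `a` into nontrivial positive elements,
a superadditive length on the positive monoid. It is meant for positive `a` in a Noetherian
system; an unbounded or empty set of lengths gives `0`. -/
noncomputable def posLength (S : Set G) (a : G) : ℕ :=
  sSup {n | ∃ L : List G, (∀ x ∈ L, x ∈ pos S ∧ x ≠ 1) ∧ L.prod = a ∧ L.length = n}

namespace IsQuasiGarsideSystem

variable (h : IsQuasiGarsideSystem S Δ) {a b c : G}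
include h

theorem leftDiv_delta (ha : a ∈ S) : LeftDiv (pos S) a Δ := ((h.mem_iff_left a).1 ha).2

theorem one_mem : (1 : G) ∈ S :=
  (h.mem_iff_left 1).2 ⟨(pos S).one_mem, Δ, h.delta_mem, (one_mul Δ).symm⟩

theorem delta_mem_simple : Δ ∈ S := (h.mem_iff_left Δ).2 ⟨h.delta_mem, LeftDiv.refl Δ⟩

theorem rightCompl_mem (ha : a ∈ S) : rightCompl Δ a ∈ S :=
  (h.mem_iff_right _).2 ⟨leftDiv_iff.1 (h.leftDiv_delta ha), a, Submonoid.subset_closure ha,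
    (mul_rightCompl a).symm⟩

theorem mem_of_leftDiv (ha : a ∈ pos S) (hab : LeftDiv (pos S) a b) (hb : b ∈ S) : a ∈ S :=
  (h.mem_iff_left a).2 ⟨ha, hab.trans (h.leftDiv_delta hb)⟩

theorem right_mem_of_mul_mem (ha : a ∈ pos S) (hb : b ∈ pos S) (hab : a * b ∈ S) : b ∈ S := by
  obtain ⟨-, c, hc, hΔ⟩ := (h.mem_iff_right _).1 hab
  exact (h.mem_iff_right b).2 ⟨hb, c * a, (pos S).mul_mem hc ha, by rw [hΔ, mul_assoc]⟩

theorem mul_mem_iff_leftDiv_rightCompl (ha : a ∈ pos S) (hb : b ∈ pos S) :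
    a * b ∈ S ↔ LeftDiv (pos S) b (rightCompl Δ a) := by
  rw [← leftDiv_mul_left_iff (a := a), mul_rightCompl, h.mem_iff_left,
    and_iff_right ((pos S).mul_mem ha hb)]

theorem tau_zpow_one_mem (ha : a ∈ S) : (τ Δ ^ (1 : ℤ)) a ∈ S := by
  rw [← rightCompl_rightCompl]
  exact h.rightCompl_mem (h.rightCompl_mem ha)

theorem tau_zpow_neg_one_mem (ha : a ∈ S) : (τ Δ ^ (-1 : ℤ)) a ∈ S := by
  have left_compl_mem {x : G} (hx : x ∈ S) : Δ * x⁻¹ ∈ S := by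
    obtain ⟨hxP, c, hc, hcx⟩ := (h.mem_iff_right x).1 hx
    rw [hcx, mul_inv_cancel_right]
    exact (h.mem_iff_left c).2 ⟨hc, x, hxP, hcx⟩
  convert left_compl_mem (left_compl_mem ha) using 1
  rw [tau_zpow_apply]
  group

theorem tau_zpow_mem (n : ℤ) (ha : a ∈ S) : (τ Δ ^ n) a ∈ S := by
  induction n with
  | zero => simpa using ha
  | succ n ih =>
    rw [add_comm, ← tau_zpow_tau_zpow]
    exact h.tau_zpow_one_mem ih
  | pred n ih =>
    rw [sub_eq_neg_add, ← tau_zpow_tau_zpow]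
    exact h.tau_zpow_neg_one_mem ih

theorem tau_zpow_mem_iff (n : ℤ) : (τ Δ ^ n) a ∈ S ↔ a ∈ S := by
  refine ⟨fun ha => ?_, h.tau_zpow_mem n⟩
  simpa [tau_zpow_tau_zpow] using h.tau_zpow_mem (-n) ha

theorem tau_zpow_pos (n : ℤ) (ha : a ∈ pos S) : (τ Δ ^ n) a ∈ pos S := by
  induction ha using Submonoid.closure_induction with
  | mem x hx => exact Submonoid.subset_closure (h.tau_zpow_mem n hx)
  | one => simp
  | mul x y _ _ hx hy =>
    rw [map_mul]
    exact (pos S).mul_mem hx hy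

theorem tau_zpow_pos_iff (n : ℤ) : (τ Δ ^ n) a ∈ pos S ↔ a ∈ pos S := by
  refine ⟨fun ha => ?_, h.tau_zpow_pos n⟩
  simpa [tau_zpow_tau_zpow] using h.tau_zpow_pos (-n) ha

theorem tau_zpow_leftDiv_iff (n : ℤ) :
    LeftDiv (pos S) ((τ Δ ^ n) a) ((τ Δ ^ n) b) ↔ LeftDiv (pos S) a b := by
  rw [leftDiv_iff, leftDiv_iff, ← map_inv, ← map_mul, h.tau_zpow_pos_iff]

/-! ### Noetherianity -/

theorem length_le_posLength {L : List G} (hL : ∀ x ∈ L, x ∈ pos S ∧ x ≠ 1) :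
    L.length ≤ posLength S L.prod := by
  obtain ⟨n, hn⟩ := h.noetherian _ (Submonoid.list_prod_mem _ fun x hx => (hL x hx).1)
  refine le_csSup ⟨n, ?_⟩ ⟨L, hL, rfl, rfl⟩
  rintro _ ⟨M, hM, hMprod, rfl⟩
  exact hn M hM hMprod

theorem exists_length_eq_posLength (ha : a ∈ pos S) :
    ∃ L : List G, (∀ x ∈ L, x ∈ pos S ∧ x ≠ 1) ∧ L.prod = a ∧ L.length = posLength S a := by
  obtain ⟨n, hn⟩ := h.noetherian a ha
  refine Nat.sSup_mem (s := {n | ∃ L : List G, (∀ x ∈ L, x ∈ pos S ∧ x ≠ 1) ∧ L.prod = a ∧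
    L.length = n}) ?_ ⟨n, ?_⟩
  · rcases eq_or_ne a 1 with rfl | ha1
    · exact ⟨0, [], by simp⟩
    · exact ⟨1, [a], by simp [ha, ha1]⟩
  · rintro _ ⟨L, hL, hprod, rfl⟩
    exact hn L hL hprod

theorem posLength_add_le_posLength_mul (ha : a ∈ pos S) (hb : b ∈ pos S) :
    posLength S a + posLength S b ≤ posLength S (a * b) := by
  obtain ⟨L, hL, rfl, hLa⟩ := h.exists_length_eq_posLength ha
  obtain ⟨M, hM, rfl, hMb⟩ := h.exists_length_eq_posLength hb
  rw [← hLa, ← hMb, ← List.length_append, ← List.prod_append]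
  exact h.length_le_posLength fun x hx => (List.mem_append.1 hx).elim (hL x) (hM x)

theorem posLength_le_posLength_tau_zpow (n : ℤ) (ha : a ∈ pos S) :
    posLength S a ≤ posLength S ((τ Δ ^ n) a) := by
  obtain ⟨L, hL, rfl, hLa⟩ := h.exists_length_eq_posLength ha
  rw [← hLa, ← List.prod_hom, ← List.length_map (τ Δ ^ n)]
  refine h.length_le_posLength fun x hx => ?_
  obtain ⟨y, hy, rfl⟩ := List.mem_map.1 hx
  exact ⟨h.tau_zpow_pos n (hL y hy).1, by simpa using (hL y hy).2⟩

theorem eq_one_of_posLength_eq_zero (ha : a ∈ pos S) (h0 : posLength S a = 0) : a = 1 := by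
  obtain ⟨L, -, rfl, hL⟩ := h.exists_length_eq_posLength ha
  rw [List.eq_nil_of_length_eq_zero (hL.trans h0), List.prod_nil]

theorem eq_one_of_mul_eq_one (ha : a ∈ pos S) (hb : b ∈ pos S) (hab : a * b = 1) : a = 1 := by
  refine h.eq_one_of_posLength_eq_zero ha ?_
  have h1 := h.posLength_add_le_posLength_mul (pos S).one_mem (pos S).one_mem
  have h2 := h.posLength_add_le_posLength_mul ha hb
  rw [mul_one] at h1
  rw [hab] at h2
  omega

theorem leftDiv_antisymm (hab : LeftDiv (pos S) a b) (hba : LeftDiv (pos S) b a) : a = b := by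
  obtain ⟨x, hx, rfl⟩ := hab
  obtain ⟨y, hy, hxy⟩ := hba
  rw [mul_assoc, left_eq_mul] at hxy
  rw [h.eq_one_of_mul_eq_one hx hy hxy, mul_one]

theorem eq_one_of_leftDiv_one (ha : a ∈ pos S) (h1 : LeftDiv (pos S) a 1) : a = 1 :=
  h.leftDiv_antisymm h1 ⟨a, ha, (one_mul a).symm⟩

theorem eq_one_of_eq_mul_tau_zpow_mul {q : ℤ} (ha : a ∈ pos S) (hb : b ∈ pos S) (hc : c ∈ pos S)
    (heq : a = b * (τ Δ ^ q) a * c) : b = 1 := by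
  refine h.eq_one_of_posLength_eq_zero hb ?_
  have hτ := h.tau_zpow_pos q ha
  have h1 := h.posLength_add_le_posLength_mul ((pos S).mul_mem hb hτ) hc
  have h2 := h.posLength_add_le_posLength_mul hb hτ
  have h3 := h.posLength_le_posLength_tau_zpow q ha
  rw [← heq] at h1
  omega

end IsQuasiGarsideSystem

theorem IsSpindleType.isQuasiSpindleType (h : IsSpindleType S Δ) : IsQuasiSpindleType S Δ where
  toIsQuasiGarsideSystem := h.isQuasiGarsideSystem
  leftDiv_total m hm hmΔ a ha b hb ham hbm := by
    have hG := h.isQuasiGarsideSystem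
    have rightDiv_compl {x y : G} (hxy : RightDiv (pos S) (rightCompl Δ x) (rightCompl Δ y)) :
        LeftDiv (pos S) y x := by
      obtain ⟨c, hc, hcx⟩ := hxy
      rw [rightCompl, rightCompl, ← mul_assoc, mul_left_inj] at hcx
      exact leftDiv_iff.2 (eq_mul_inv_iff_mul_eq.1 hcx ▸ hc)
    obtain ⟨d, hd, -, hda, hdb, hmax⟩ :=
      h.rightGcd _ (hG.rightCompl_mem (hG.mem_of_leftDiv ha ham hm))
        _ (hG.rightCompl_mem (hG.mem_of_leftDiv hb hbm hm))
    have hmP := Submonoid.subset_closure (hG.rightCompl_mem hm)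
    obtain ⟨c, hc, hcm⟩ := hmax (rightCompl Δ m) hmP
      ⟨a⁻¹ * m, leftDiv_iff.1 ham, by rw [rightCompl, rightCompl]; group⟩
      ⟨b⁻¹ * m, leftDiv_iff.1 hbm, by rw [rightCompl, rightCompl]; group⟩
    simp only [Set.mem_insert_iff, Set.mem_singleton_iff] at hd
    rcases hd with rfl | rfl | rfl
    · exact Or.inr (rightDiv_compl hdb)
    · exact Or.inl (rightDiv_compl hda)
    · have hc1 := hG.eq_one_of_mul_eq_one hc hmP hcm.symm
      rw [hc1, one_mul, eq_comm, rightCompl_eq_one] at hcm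
      exact absurd hcm hmΔ

/-! ### Powers of `Δ`, infimum and supremum -/

theorem IsInf.delta_ne_one {b : G} {p : ℤ} (hb : IsInf S Δ b p) : Δ ≠ 1 := by
  rintro rfl
  have hp : p + 1 ≤ p := hb.2 (by simpa using hb.1)
  omega

theorem IsSummitInf.of_isConj {b x : G} {m : ℤ} (hb : IsSummitInf S Δ b m) (hbx : IsConj b x) :
    IsSummitInf S Δ x m := by
  obtain ⟨⟨y, hby, hy⟩, hmax⟩ := hb
  exact ⟨⟨y, hbx.symm.trans hby, hy⟩, fun n ⟨z, hxz, hz⟩ => hmax ⟨z, hbx.trans hxz, hz⟩⟩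

theorem IsSummitSup.of_isConj {b x : G} {m : ℤ} (hb : IsSummitSup S Δ b m) (hbx : IsConj b x) :
    IsSummitSup S Δ x m := by
  obtain ⟨⟨y, hby, hy⟩, hmin⟩ := hb
  exact ⟨⟨y, hbx.symm.trans hby, hy⟩, fun n ⟨z, hxz, hz⟩ => hmin ⟨z, hbx.trans hxz, hz⟩⟩

theorem isSummitInf_of_forall_le {b : G} {m : ℤ} (hm : LeftDiv (pos S) (Δ ^ m) b)
    (hmax : ∀ y, IsConj b y → ∀ n : ℤ, LeftDiv (pos S) (Δ ^ n) y → n ≤ m) :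
    IsSummitInf S Δ b m :=
  ⟨⟨b, IsConj.refl b, hm, hmax b (IsConj.refl b)⟩, fun n ⟨y, hby, hy⟩ => hmax y hby n hy.1⟩

theorem isConj_inv_inv {a b : G} (hab : IsConj a b) : IsConj a⁻¹ b⁻¹ := by
  obtain ⟨c, rfl⟩ := isConj_iff.1 hab
  exact isConj_iff.2 ⟨c, by group⟩

theorem le_of_forall_add_mul_le_mul {k q m : ℤ} (hk : ∀ n : ℕ, k + q * n ≤ m * n) : q ≤ m := by
  by_contra! hmq
  have hn := hk ((-k).toNat + 1)
  have hk' := Int.self_le_toNat (-k)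
  push_cast at hn
  nlinarith

namespace IsQuasiGarsideSystem

variable (h : IsQuasiGarsideSystem S Δ) {b x y : G} {m n : ℤ}
include h

theorem zpow_leftDiv_iff_rightDiv : LeftDiv (pos S) (Δ ^ n) b ↔ RightDiv (pos S) (Δ ^ n) b := by
  constructor
  · rintro ⟨c, hc, rfl⟩
    exact ⟨(τ Δ ^ (-n)) c, h.tau_zpow_pos _ hc, by rw [tau_zpow_apply]; group⟩
  · rintro ⟨c, hc, rfl⟩
    exact ⟨_, h.tau_zpow_pos n hc, mul_zpow_eq_zpow_mul_tau n c⟩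

theorem zpow_neg_leftDiv_inv_iff : LeftDiv (pos S) (Δ ^ (-n)) b⁻¹ ↔ LeftDiv (pos S) b (Δ ^ n) := by
  rw [h.zpow_leftDiv_iff_rightDiv, RightDiv, LeftDiv]
  simp only [zpow_neg, eq_mul_inv_iff_mul_eq, inv_mul_eq_iff_eq_mul]

theorem leftDiv_zpow_of_le (hmn : m ≤ n) (hb : LeftDiv (pos S) (Δ ^ n) b) :
    LeftDiv (pos S) (Δ ^ m) b := by
  refine LeftDiv.trans ⟨Δ ^ (n - m).toNat, pow_mem h.delta_mem _, ?_⟩ hb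
  rw [← zpow_natCast, Int.toNat_of_nonneg (by omega), ← zpow_add, add_sub_cancel]

theorem zpow_add_leftDiv_mul (hx : LeftDiv (pos S) (Δ ^ m) x) (hy : LeftDiv (pos S) (Δ ^ n) y) :
    LeftDiv (pos S) (Δ ^ (m + n)) (x * y) := by
  obtain ⟨c, hc, rfl⟩ := hx
  obtain ⟨e, he, rfl⟩ := hy
  refine ⟨(τ Δ ^ n) c * e, (pos S).mul_mem (h.tau_zpow_pos n hc) he, ?_⟩
  rw [tau_zpow_apply, zpow_add]
  group

theorem zpow_mul_leftDiv_pow (hx : LeftDiv (pos S) (Δ ^ m) x) (k : ℕ) :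
    LeftDiv (pos S) (Δ ^ (m * k)) (x ^ k) := by
  induction k with
  | zero => simpa using LeftDiv.refl (1 : G)
  | succ k ih =>
    rw [pow_succ, Nat.cast_succ, mul_add_one]
    exact h.zpow_add_leftDiv_mul ih hx

theorem exists_leftDiv_zpow (hb : b ∈ pos S) : ∃ k : ℤ, LeftDiv (pos S) b (Δ ^ k) := by
  induction hb using Submonoid.closure_induction with
  | mem x hx => exact ⟨1, by simpa using h.leftDiv_delta hx⟩
  | one => exact ⟨0, by simpa using LeftDiv.refl (1 : G)⟩
  | mul x y _ _ hx hy =>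
    obtain ⟨m, hm⟩ := hx
    obtain ⟨n, hn⟩ := hy
    rw [← h.zpow_neg_leftDiv_inv_iff] at hm hn
    refine ⟨m + n, ?_⟩
    rw [← h.zpow_neg_leftDiv_inv_iff, mul_inv_rev, neg_add_rev]
    exact h.zpow_add_leftDiv_mul hn hm

theorem exists_eq_mul_zpow (g : G) : ∃ a ∈ pos S, ∃ k : ℤ, g = a * Δ ^ k := by
  obtain ⟨a, ha, b, hb, rfl⟩ := h.rightFrac g
  obtain ⟨k, hk⟩ := h.exists_leftDiv_zpow hb
  obtain ⟨c, hc, hbc⟩ := h.zpow_leftDiv_iff_rightDiv.1 (h.zpow_neg_leftDiv_inv_iff.2 hk)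
  exact ⟨a * c, (pos S).mul_mem ha hc, -k, by rw [hbc, mul_assoc]⟩

theorem exists_zpow_leftDiv (g : G) : ∃ k : ℤ, LeftDiv (pos S) (Δ ^ k) g := by
  obtain ⟨a, ha, k, rfl⟩ := h.exists_eq_mul_zpow g
  exact ⟨k, h.zpow_leftDiv_iff_rightDiv.2 ⟨a, ha, rfl⟩⟩

theorem isSup_iff_isInf_inv : IsSup S Δ b m ↔ IsInf S Δ b⁻¹ (-m) := by
  refine and_congr h.zpow_neg_leftDiv_inv_iff.symm ⟨fun hm n hn => ?_, fun hm n hn => ?_⟩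
  · refine le_neg_of_le_neg (hm (h.zpow_neg_leftDiv_inv_iff.1 ?_))
    rwa [neg_neg]
  · exact neg_le_neg_iff.1 (hm (h.zpow_neg_leftDiv_inv_iff.2 hn))

theorem isSummitSup_of_isSummitInf_inv (hb : IsSummitInf S Δ b⁻¹ (-m)) : IsSummitSup S Δ b m := by
  obtain ⟨⟨y, hy, hym⟩, hmax⟩ := hb
  have isConj_inv_right {z : G} : IsConj b z⁻¹ ↔ IsConj b⁻¹ z :=
    ⟨fun hz => by simpa using isConj_inv_inv hz, fun hz => by simpa using isConj_inv_inv hz⟩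
  refine ⟨⟨y⁻¹, isConj_inv_right.2 hy, h.isSup_iff_isInf_inv.2 (by rwa [inv_inv])⟩, ?_⟩
  rintro n ⟨z, hz, hzn⟩
  exact neg_le_neg_iff.1 (hmax ⟨z⁻¹, isConj_inv_inv hz, h.isSup_iff_isInf_inv.1 hzn⟩)

/-- Conjugation by `c` changes the infimum of `x ^ n` by at most a constant depending on `c`. -/
theorem isSummitInf_of_isInf_pow (hx : ∀ n : ℕ, IsInf S Δ (x ^ n) (m * n)) :
    IsSummitInf S Δ x m := by
  refine isSummitInf_of_forall_le (by simpa using (hx 1).1) fun y hxy q hq => ?_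
  obtain ⟨c, rfl⟩ := isConj_iff.1 hxy
  obtain ⟨k, hk⟩ := h.exists_zpow_leftDiv c⁻¹
  obtain ⟨l, hl⟩ := h.exists_zpow_leftDiv c
  refine le_of_forall_add_mul_le_mul (k := k + l) fun n => ?_
  have hn := h.zpow_add_leftDiv_mul (h.zpow_add_leftDiv_mul hk (h.zpow_mul_leftDiv_pow hq n)) hl
  rw [conj_pow, show c⁻¹ * (c * x ^ n * c⁻¹) * c = x ^ n by group] at hn
  linarith [(hx n).2 hn]

/-- An element dividing `Δ ^ r` has no conjugate divisible by `Δ ^ r`, unless it is `Δ ^ r`: if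
`x = Δ ^ r * u⁻¹` and a positive `e` conjugates `x` to a multiple of `Δ ^ r`, then `e` is a proper
multiple of its own `τ`-twist, against Noetherianity. -/
theorem eq_zpow_of_isConj {r : ℤ} (hx : LeftDiv (pos S) x (Δ ^ r)) (hxy : IsConj x y)
    (hy : LeftDiv (pos S) (Δ ^ r) y) : x = Δ ^ r := by
  obtain ⟨c, rfl⟩ := isConj_iff.1 hxy
  obtain ⟨e, he, k, hce⟩ := h.exists_eq_mul_zpow c⁻¹
  obtain ⟨u, hu, hxu⟩ := hx
  obtain ⟨w, hw, hyw⟩ := hy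
  have heq : e = u * (τ Δ ^ r) e * (τ Δ ^ (-k)) w := by
    obtain rfl : e = c⁻¹ * Δ ^ (-k) := by rw [hce]; group
    have hu' : u = x⁻¹ * Δ ^ r := by rw [hxu, inv_mul_cancel_left]
    have hw' : w = Δ ^ (-r) * (c * x * c⁻¹) := by rw [hyw]; group
    rw [tau_zpow_apply, tau_zpow_apply, hu', hw']
    group
  rw [hxu, h.eq_one_of_eq_mul_tau_zpow_mul he hu (h.tau_zpow_pos _ hw) heq, mul_one]

theorem isSummitInf_of_leftDiv_zpow (hm : LeftDiv (pos S) (Δ ^ m) x)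
    (hx : LeftDiv (pos S) x (Δ ^ (m + 1))) (hne : x ≠ Δ ^ (m + 1)) : IsSummitInf S Δ x m := by
  refine isSummitInf_of_forall_le hm fun y hxy n hn => ?_
  by_contra! hmn
  exact hne (h.eq_zpow_of_isConj hx hxy (h.leftDiv_zpow_of_le hmn hn))

theorem isSummitSup_of_leftDiv_zpow (hm : LeftDiv (pos S) (Δ ^ m) x)
    (hx : LeftDiv (pos S) x (Δ ^ (m + 1))) (hne : x ≠ Δ ^ m) : IsSummitSup S Δ x (m + 1) := by
  have hadd : -(m + 1) + 1 = -m := by ring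
  refine h.isSummitSup_of_isSummitInf_inv
    (h.isSummitInf_of_leftDiv_zpow (h.zpow_neg_leftDiv_inv_iff.2 hx) ?_ ?_)
  · rwa [← h.zpow_neg_leftDiv_inv_iff, inv_inv, hadd, neg_neg]
  · rwa [hadd, zpow_neg, Ne, inv_inj]

end IsQuasiGarsideSystem

/-! ### Left-weighted pairs and normal words -/

/-- Left-weighted pairs `(a, b)`: no nontrivial positive left divisor of `b` can be moved into `a`
keeping the product simple. For simple `a` and positive `b` this is the condition `∂ a ∧ b = 1` on
consecutive factors of a left normal form. -/
def LeftWeighted (S : Set G) (a b : G) : Prop :=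
  ∀ e ∈ pos S, a * e ∈ S → LeftDiv (pos S) e b → e = 1

/-- Normal words: the words `s_1, …, s_l` in simple elements other than `1` and `Δ` in which
consecutive letters are left-weighted, i.e. those for which `Δ ^ p * s_1 ⋯ s_l` is a left normal
form for one, or equivalently every, integer `p`. -/
structure IsNormalWord (S : Set G) (Δ : G) (s : List G) : Prop where
  mem : ∀ x ∈ s, x ∈ S
  ne_one : ∀ x ∈ s, x ≠ 1
  ne_delta : ∀ x ∈ s, x ≠ Δ
  chain : s.IsChain (LeftWeighted S)

theorem LeftWeighted.mono_right {a b c : G} (hab : LeftWeighted S a b)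
    (hc : LeftDiv (pos S) c b) : LeftWeighted S a c :=
  fun e he hae hec => hab e he hae (hec.trans hc)

namespace IsNormalWord

variable {a b : G} {s t : List G}

theorem singleton (ha : a ∈ S) (ha1 : a ≠ 1) (haΔ : a ≠ Δ) : IsNormalWord S Δ [a] where
  mem := List.forall_mem_singleton.2 ha
  ne_one := List.forall_mem_singleton.2 ha1
  ne_delta := List.forall_mem_singleton.2 haΔ
  chain := List.isChain_singleton a

theorem prod_mem (hs : IsNormalWord S Δ s) : s.prod ∈ pos S :=
  Submonoid.list_prod_mem _ fun x hx => Submonoid.subset_closure (hs.mem x hx)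

theorem of_isInfix (ht : IsNormalWord S Δ t) (hst : s <:+: t) : IsNormalWord S Δ s where
  mem x hx := ht.mem x (hst.subset hx)
  ne_one x hx := ht.ne_one x (hst.subset hx)
  ne_delta x hx := ht.ne_delta x (hst.subset hx)
  chain := by
    obtain ⟨u, v, rfl⟩ := hst
    exact ht.chain.left_of_append.right_of_append

theorem append (hs : IsNormalWord S Δ s) (ht : IsNormalWord S Δ t)
    (hst : ∀ x ∈ s.getLast?, ∀ y ∈ t.head?, LeftWeighted S x y) : IsNormalWord S Δ (s ++ t) where
  mem x hx := (List.mem_append.1 hx).elim (hs.mem x) (ht.mem x)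
  ne_one x hx := (List.mem_append.1 hx).elim (hs.ne_one x) (ht.ne_one x)
  ne_delta x hx := (List.mem_append.1 hx).elim (hs.ne_delta x) (ht.ne_delta x)
  chain := List.isChain_append.2 ⟨hs.chain, ht.chain, hst⟩

end IsNormalWord

theorem factor_succ {s : List G} {j : ℕ} (hj : j < s.length) : factor s (j + 1) = s[j] :=
  List.getD_eq_getElem s 1 hj

theorem factor_succ_mul_seg {s : List G} {j : ℕ} (hj : j < s.length) :
    seg s (j + 1) s.length = factor s (j + 1) * seg s (j + 2) s.length := by
  simp only [seg, List.take_length, Nat.add_sub_cancel, factor_succ hj]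
  rw [List.drop_eq_getElem_cons hj, List.prod_cons]
  rfl

namespace IsQuasiGarsideSystem

variable (h : IsQuasiGarsideSystem S Δ) {a b c t : G} {p q : ℤ} {s : List G}
include h

theorem leftWeighted_iff_isLeftGcd (ha : a ∈ S) (hb : b ∈ pos S) :
    LeftWeighted S a b ↔ IsLeftGcd (pos S) b (rightCompl Δ a) 1 := by
  have haP := Submonoid.subset_closure ha
  have one_leftDiv {x : G} (hx : x ∈ pos S) : LeftDiv (pos S) 1 x := ⟨x, hx, (one_mul x).symm⟩
  refine ⟨fun hab => ⟨(pos S).one_mem, one_leftDiv hb,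
    one_leftDiv (Submonoid.subset_closure (h.rightCompl_mem ha)), fun e he heb hea => ?_⟩,
    fun hab e he hae heb => ?_⟩
  · rw [hab e he ((h.mul_mem_iff_leftDiv_rightCompl haP he).2 hea) heb]
    exact LeftDiv.refl 1
  · exact h.eq_one_of_leftDiv_one he
      (hab.2.2.2 e he heb ((h.mul_mem_iff_leftDiv_rightCompl haP he).1 hae))

theorem leftWeighted_mul_left (hab : LeftWeighted S a b) (ht : t ∈ pos S) (ha : a ∈ pos S) :
    LeftWeighted S (t * a) b := fun e he hae heb =>
  hab e he (h.right_mem_of_mul_mem ht ((pos S).mul_mem ha he) (mul_assoc t a e ▸ hae)) heb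

theorem leftWeighted_tau_zpow (n : ℤ) (hab : LeftWeighted S a b) :
    LeftWeighted S ((τ Δ ^ n) a) ((τ Δ ^ n) b) := by
  intro e he hae heb
  obtain ⟨e, rfl⟩ := (τ Δ ^ n).surjective e
  rw [← map_mul, h.tau_zpow_mem_iff] at hae
  rw [hab e ((h.tau_zpow_pos_iff n).1 he) hae ((h.tau_zpow_leftDiv_iff n).1 heb), map_one]

theorem leftWeighted_rightCompl (ha : a ∈ S) (hb : b ∈ S) (hab : LeftWeighted S a b) :
    LeftWeighted S (rightCompl Δ b) ((τ Δ ^ (1 : ℤ)) (rightCompl Δ a)) := by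
  intro e he hbe hea
  obtain ⟨e, rfl⟩ := (τ Δ ^ (1 : ℤ)).surjective e
  rw [h.mul_mem_iff_leftDiv_rightCompl (Submonoid.subset_closure (h.rightCompl_mem hb)) he,
    rightCompl_rightCompl, h.tau_zpow_leftDiv_iff] at hbe
  rw [h.tau_zpow_leftDiv_iff] at hea
  rw [h.tau_zpow_pos_iff] at he
  have hae := (h.mul_mem_iff_leftDiv_rightCompl (Submonoid.subset_closure ha) he).2 hea
  rw [hab e he hae hbe, map_one]

theorem eq_delta_of_leftWeighted (ha : a ∈ S) (hab : LeftWeighted S a b)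
    (hb : LeftDiv (pos S) (rightCompl Δ a) b) : a = Δ := by
  refine rightCompl_eq_one.1 (hab _ (Submonoid.subset_closure (h.rightCompl_mem ha)) ?_ hb)
  rw [mul_rightCompl]
  exact h.delta_mem_simple

theorem isNormalWord_map_tau_zpow (n : ℤ) (hs : IsNormalWord S Δ s) :
    IsNormalWord S Δ (s.map (τ Δ ^ n)) where
  mem := List.forall_mem_map.2 fun x hx => h.tau_zpow_mem n (hs.mem x hx)
  ne_one := List.forall_mem_map.2 fun x hx => by simpa using hs.ne_one x hx
  ne_delta := List.forall_mem_map.2 fun x hx hτ =>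
    hs.ne_delta x hx ((τ Δ ^ n).injective (hτ.trans (tau_zpow_delta n).symm))
  chain := (List.isChain_map _).2 (hs.chain.imp fun _ _ => h.leftWeighted_tau_zpow n)

theorem leftDiv_head (hs : IsNormalWord S Δ (a :: s)) (hc : c ∈ S)
    (hcs : LeftDiv (pos S) c (a :: s).prod) : LeftDiv (pos S) c a := by
  induction s generalizing a c with
  | nil => simpa using hcs
  | cons b s ih =>
    have ha := hs.mem a List.mem_cons_self
    have hbs : IsNormalWord S Δ (b :: s) := hs.of_isInfix (List.suffix_cons _ _).isInfix
    obtain ⟨_, ⟨e, he, rfl⟩, hce, hlcm⟩ := h.rightLcm a ha c hc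
    have hae : a * e ∈ S := (h.mem_iff_left _).2
      ⟨(pos S).mul_mem (Submonoid.subset_closure ha) he,
        hlcm Δ (h.leftDiv_delta ha) (h.leftDiv_delta hc)⟩
    have hes : LeftDiv (pos S) e (b :: s).prod :=
      leftDiv_mul_left_iff.1 (hlcm _ (leftDiv_mul_right a hbs.prod_mem) hcs)
    have heb := ih hbs (h.right_mem_of_mul_mem (Submonoid.subset_closure ha) he hae) hes
    rwa [(List.isChain_cons_cons.1 hs.chain).1 e he hae heb, mul_one] at hce

theorem isLeftGcd_head (hs : IsNormalWord S Δ (a :: s)) :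
    IsLeftGcd (pos S) Δ (a :: s).prod a := by
  have ha := hs.mem a List.mem_cons_self
  refine ⟨Submonoid.subset_closure ha, h.leftDiv_delta ha, leftDiv_mul_right a
    (hs.of_isInfix (List.suffix_cons a s).isInfix).prod_mem, fun c hc hcΔ hcs => ?_⟩
  exact h.leftDiv_head hs ((h.mem_iff_left c).2 ⟨hc, hcΔ⟩) hcs

theorem isInf_of_isNormalWord (hΔ : Δ ≠ 1) (p : ℤ) (hs : IsNormalWord S Δ s) :
    IsInf S Δ (Δ ^ p * s.prod) p := by
  refine ⟨leftDiv_mul_right _ hs.prod_mem, fun n hn => ?_⟩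
  by_contra! hpn
  have hdelta : LeftDiv (pos S) Δ s.prod := by
    rw [← leftDiv_mul_left_iff (a := Δ ^ p), ← zpow_add_one]
    exact h.leftDiv_zpow_of_le hpn hn
  cases s with
  | nil => exact hΔ (h.eq_one_of_leftDiv_one h.delta_mem hdelta)
  | cons a s =>
    have ha := h.leftDiv_head hs h.delta_mem_simple hdelta
    exact hs.ne_delta a List.mem_cons_self
      (h.leftDiv_antisymm (h.leftDiv_delta (hs.mem a List.mem_cons_self)) ha)

theorem isLNF_of_isNormalWord (hΔ : Δ ≠ 1) (p : ℤ) (hs : IsNormalWord S Δ s) :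
    IsLNF S Δ (Δ ^ p * s.prod) p s where
  isInf := h.isInf_of_isNormalWord hΔ p hs
  eq := rfl
  greedy i hi hil := by
    obtain ⟨j, rfl⟩ := Nat.exists_eq_add_of_le' hi
    have hdrop := List.drop_eq_getElem_cons hil
    rw [seg, List.take_length, Nat.add_sub_cancel, factor_succ hil, hdrop]
    exact h.isLeftGcd_head (hdrop ▸ hs.of_isInfix (List.drop_suffix j s).isInfix)
  last_ne hne := by
    obtain ⟨j, hj⟩ := Nat.exists_eq_succ_of_ne_zero (List.length_eq_zero_iff.not.2 hne)
    rw [hj, factor_succ (by omega)]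
    exact hs.ne_one _ (List.getElem_mem _)

theorem factor_mem_of_isLNF (hb : IsLNF S Δ b p s) {i : ℕ} (hi : 1 ≤ i) (hil : i ≤ s.length) :
    factor s i ∈ S :=
  (h.mem_iff_left _).2 ⟨(hb.greedy i hi hil).1, (hb.greedy i hi hil).2.1⟩

theorem mem_of_isLNF (hb : IsLNF S Δ b p s) : ∀ x ∈ s, x ∈ S := fun x hx => by
  obtain ⟨j, hj, rfl⟩ := List.getElem_of_mem hx
  exact factor_succ hj ▸ h.factor_mem_of_isLNF hb (Nat.le_add_left 1 j) hj

theorem isChain_leftWeighted_of_isLNF (hb : IsLNF S Δ b p s) : s.IsChain (LeftWeighted S) := by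
  refine List.isChain_iff_getElem.2 fun j hj e he hse hes => ?_
  have hgcd := hb.greedy (j + 1) (by omega) (by omega)
  have hnext := hb.greedy (j + 2) (by omega) hj
  rw [factor_succ_mul_seg (by omega), factor_succ (by omega)] at hgcd
  rw [factor_succ hj] at hnext
  have hle := hgcd.2.2.2 _ (Submonoid.subset_closure hse) (h.leftDiv_delta hse)
    (leftDiv_mul_left_iff.2 (hes.trans hnext.2.2.1))
  rw [← mul_one s[j], mul_assoc, leftDiv_mul_left_iff, one_mul] at hle
  exact h.eq_one_of_leftDiv_one he hle

theorem isNormalWord_of_isLNF (hb : IsLNF S Δ b p s) : IsNormalWord S Δ s := by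
  have mem := h.mem_of_isLNF hb
  have chain : s.IsChain fun a b => LeftWeighted S a b ∧ a ∈ S ∧ b ∈ S :=
    (h.isChain_leftWeighted_of_isLNF hb).imp_of_mem_imp fun a b ha hb hab =>
      ⟨hab, mem a ha, mem b hb⟩
  refine ⟨mem, ?_, ?_, h.isChain_leftWeighted_of_isLNF hb⟩
  · refine chain.backwards_induction (· ≠ 1) s (fun a b hab hb1 ha1 => hb1 ?_) fun hne => ?_
    · subst ha1
      obtain ⟨h1b, -, hb⟩ := hab
      exact h1b b (Submonoid.subset_closure hb) (by rwa [one_mul]) (LeftDiv.refl b)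
    · rw [List.getLast_eq_getElem, ← factor_succ]
      have hlen := List.length_pos_of_ne_nil hne
      rw [Nat.sub_add_cancel hlen]
      exact hb.last_ne hne
  · refine chain.induction (· ≠ Δ) s (fun a b hab hane hbΔ => hane ?_) fun hne hhead => ?_
    · subst hbΔ
      obtain ⟨haΔ, ha, -⟩ := hab
      exact h.eq_delta_of_leftWeighted ha haΔ (h.leftDiv_delta (h.rightCompl_mem ha))
    · have hp : LeftDiv (pos S) (Δ ^ (p + 1)) b := by
        rw [hb.eq, zpow_add_one, ← List.cons_head_tail hne, List.prod_cons, hhead, ← mul_assoc]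
        exact leftDiv_mul_right _ (Submonoid.list_prod_mem _ fun x hx =>
          Submonoid.subset_closure (mem x (List.mem_of_mem_tail hx)))
      exact absurd (hb.isInf.2 hp) (by omega)

theorem isNormalWord_eq_of_prod_eq {t : List G} (hs : IsNormalWord S Δ s) (ht : IsNormalWord S Δ t)
    (hst : s.prod = t.prod) : s = t := by
  have ne_one_of_cons {a : G} {u : List G} (hu : IsNormalWord S Δ (a :: u)) :
      (a :: u).prod ≠ 1 := fun h1 => hu.ne_one a List.mem_cons_self <|
    h.eq_one_of_leftDiv_one (h.isLeftGcd_head hu).1 (h1 ▸ (h.isLeftGcd_head hu).2.2.1)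
  induction s generalizing t with
  | nil =>
    cases t with
    | nil => rfl
    | cons b t => exact absurd hst.symm (ne_one_of_cons ht)
  | cons a s ih =>
    cases t with
    | nil => exact absurd hst (ne_one_of_cons hs)
    | cons b t =>
      have ha := h.isLeftGcd_head hs
      have hb := h.isLeftGcd_head ht
      obtain rfl : a = b := h.leftDiv_antisymm
        (hb.2.2.2 a ha.1 ha.2.1 (hst ▸ ha.2.2.1)) (ha.2.2.2 b hb.1 hb.2.1 (hst ▸ hb.2.2.1))
      rw [List.prod_cons, List.prod_cons, mul_right_inj] at hst
      rw [ih (hs.of_isInfix (List.suffix_cons a s).isInfix)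
        (ht.of_isInfix (List.suffix_cons a t).isInfix) hst]

theorem isLNF_unique {t : List G} (hs : IsLNF S Δ b p s) (ht : IsLNF S Δ b q t) :
    p = q ∧ s = t := by
  obtain rfl : p = q := hs.isInf.unique ht.isInf
  exact ⟨rfl, h.isNormalWord_eq_of_prod_eq (h.isNormalWord_of_isLNF hs)
    (h.isNormalWord_of_isLNF ht) (mul_left_cancel (hs.eq.symm.trans ht.eq))⟩

theorem decycling_eq (hb : IsLNF S Δ b p s) :
    decycling S Δ b = Δ ^ p * (τ Δ ^ p) (factor s s.length) * seg s 1 (s.length - 1) := by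
  have hex : ∃ q : ℤ × List G, IsLNF S Δ b q.1 q.2 := ⟨(p, s), hb⟩
  obtain ⟨hp, hs⟩ := h.isLNF_unique hex.choose_spec hb
  rw [decycling, dif_pos hex, hp, hs]

end IsQuasiGarsideSystem

/-! ### Cyclically normal words and the super summit set -/

/-- Cyclically normal words: normal words `s_1, …, s_l` which stay normal when `τ ^ p (s_l)` is put
in front of `s_1`. These are the words `s` for which the left normal forms of all powers of
`Δ ^ p * s_1 ⋯ s_l` are obtained by concatenating `τ`-twists of `s`. -/
structure IsCyclicallyNormalWord (S : Set G) (Δ : G) (p : ℤ) (s : List G) : Prop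
    extends IsNormalWord S Δ s where
  leftWeighted : ∀ x ∈ s.getLast?, ∀ y ∈ s.head?, LeftWeighted S ((τ Δ ^ p) x) y

theorem prod_eq_seg_mul_factor (s : List G) :
    s.prod = seg s 1 (s.length - 1) * factor s s.length := by
  induction s using List.reverseRecOn with
  | nil => simp [seg, factor]
  | append_singleton s a => simp [seg, factor]

namespace IsQuasiGarsideSystem

variable (h : IsQuasiGarsideSystem S Δ) {b x : G} {p : ℤ} {s : List G}
include h

theorem exists_isNormalWord_inv_prod_eq (hs : IsNormalWord S Δ s) :
    ∃ t, IsNormalWord S Δ t ∧ s.prod⁻¹ = t.prod * Δ ^ (-s.length : ℤ) ∧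
      ∀ x ∈ t.getLast?, ∃ y ∈ s.head?, x = (τ Δ ^ (s.length - 1 : ℤ)) (rightCompl Δ y) := by
  induction s with
  | nil => exact ⟨[], hs, by simp, by simp⟩
  | cons a s ih =>
    obtain ⟨t, ht, hprod, hlast⟩ := ih (hs.of_isInfix (List.suffix_cons a s).isInfix)
    have ha := hs.mem a List.mem_cons_self
    have hcompl : IsNormalWord S Δ [rightCompl Δ a] := .singleton (h.rightCompl_mem ha)
      (rightCompl_eq_one.not.2 (hs.ne_delta a List.mem_cons_self))
      (rightCompl_eq_delta.not.2 (hs.ne_one a List.mem_cons_self))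
    refine ⟨t ++ [(τ Δ ^ (s.length : ℤ)) (rightCompl Δ a)],
      ht.append (h.isNormalWord_map_tau_zpow s.length hcompl) ?_, ?_, by simp⟩
    · intro x hx _ hy
      obtain rfl := Option.mem_some_iff.1 hy
      obtain ⟨y, hy, rfl⟩ := hlast x hx
      have hay := (List.isChain_cons.1 hs.chain).1 y hy
      have hys := hs.mem y (List.mem_cons_of_mem a (List.mem_of_mem_head? hy))
      convert h.leftWeighted_tau_zpow (s.length - 1) (h.leftWeighted_rightCompl ha hys hay) using 1
      rw [tau_zpow_tau_zpow, sub_add_cancel]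
    · rw [List.prod_cons, mul_inv_rev, hprod, List.prod_append, List.prod_singleton,
        tau_zpow_apply, rightCompl, List.length_cons, Nat.cast_succ]
      group

theorem isSup_of_isNormalWord (hΔ : Δ ≠ 1) (p : ℤ) (hs : IsNormalWord S Δ s) :
    IsSup S Δ (Δ ^ p * s.prod) (p + s.length) := by
  obtain ⟨t, ht, hprod, -⟩ := h.exists_isNormalWord_inv_prod_eq hs
  rw [h.isSup_iff_isInf_inv]
  convert h.isInf_of_isNormalWord hΔ (-(p + s.length))
    (h.isNormalWord_map_tau_zpow (-(p + s.length)) ht) using 1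
  rw [List.prod_hom, ← mul_zpow_eq_zpow_mul_tau, mul_inv_rev, hprod]
  group

theorem exists_isNormalWord_pow_eq (hs : IsCyclicallyNormalWord S Δ p s) (n : ℕ) :
    ∃ t, IsNormalWord S Δ t ∧ (Δ ^ p * s.prod) ^ n = Δ ^ (p * n) * t.prod ∧
      t.length = s.length * n ∧ ∀ x ∈ t.getLast?, x ∈ s.getLast? := by
  induction n with
  | zero => exact ⟨[], hs.of_isInfix ⟨[], s, rfl⟩, by simp, by simp, by simp⟩
  | succ n ih =>
    obtain ⟨t, ht, hprod, hlen, hlast⟩ := ih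
    refine ⟨t.map (τ Δ ^ p) ++ s, (h.isNormalWord_map_tau_zpow p ht).append hs.toIsNormalWord ?_,
      ?_, ?_, fun x hx => ?_⟩
    · intro x hx y hy
      rw [List.getLast?_map, Option.mem_map] at hx
      obtain ⟨x, hx, rfl⟩ := hx
      exact hs.leftWeighted x (hlast x hx) y hy
    · rw [pow_succ, hprod, List.prod_append, List.prod_hom, tau_zpow_apply, Nat.cast_succ,
        mul_add_one, zpow_add]
      group
    · rw [List.length_append, List.length_map, hlen, Nat.mul_succ]
    · rcases s.eq_nil_or_concat' with rfl | ⟨s, a, rfl⟩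
      · obtain rfl : t = [] := List.eq_nil_of_length_eq_zero (by simpa using hlen)
        simp at hx
      · simpa [← List.append_assoc] using hx

theorem isSummitInf_of_isCyclicallyNormalWord (hΔ : Δ ≠ 1) (hs : IsCyclicallyNormalWord S Δ p s) :
    IsSummitInf S Δ (Δ ^ p * s.prod) p := by
  refine h.isSummitInf_of_isInf_pow fun n => ?_
  obtain ⟨t, ht, hprod, -⟩ := h.exists_isNormalWord_pow_eq hs n
  rw [hprod]
  exact h.isInf_of_isNormalWord hΔ _ ht

theorem isSummitSup_of_isCyclicallyNormalWord (hΔ : Δ ≠ 1) (hs : IsCyclicallyNormalWord S Δ p s) :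
    IsSummitSup S Δ (Δ ^ p * s.prod) (p + s.length) := by
  refine h.isSummitSup_of_isSummitInf_inv (h.isSummitInf_of_isInf_pow fun n => ?_)
  obtain ⟨t, ht, hprod, hlen, -⟩ := h.exists_isNormalWord_pow_eq hs n
  rw [inv_pow, neg_mul, ← h.isSup_iff_isInf_inv, hprod, add_mul, ← Nat.cast_mul, ← hlen]
  exact h.isSup_of_isNormalWord hΔ _ ht

theorem isSummitInf_and_isSummitSup_of_isNormalWord (hΔ : Δ ≠ 1) (hs : IsNormalWord S Δ s)
    (hcyc : s.length = 1 ∨ IsCyclicallyNormalWord S Δ p s) :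
    IsSummitInf S Δ (Δ ^ p * s.prod) p ∧ IsSummitSup S Δ (Δ ^ p * s.prod) (p + s.length) := by
  rcases hcyc with hlen | hcyc
  · have hinf := (h.isInf_of_isNormalWord hΔ p hs).1
    have hsup := (h.isSup_of_isNormalWord hΔ p hs).1
    obtain ⟨a, rfl⟩ := List.length_eq_one_iff.1 hlen
    refine ⟨h.isSummitInf_of_leftDiv_zpow hinf hsup ?_, h.isSummitSup_of_leftDiv_zpow hinf hsup ?_⟩
    · simpa [zpow_add_one] using hs.ne_delta a List.mem_cons_self
    · simpa using hs.ne_one a List.mem_cons_self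
  · exact ⟨h.isSummitInf_of_isCyclicallyNormalWord hΔ hcyc,
      h.isSummitSup_of_isCyclicallyNormalWord hΔ hcyc⟩

theorem mem_SSS_of_isNormalWord (hΔ : Δ ≠ 1) (hs : IsNormalWord S Δ s)
    (hcyc : s.length = 1 ∨ IsCyclicallyNormalWord S Δ p s) (hb : IsConj b (Δ ^ p * s.prod)) :
    Δ ^ p * s.prod ∈ SSS S Δ b := by
  obtain ⟨hinf, hsup⟩ := h.isSummitInf_and_isSummitSup_of_isNormalWord hΔ hs hcyc
  exact ⟨hb, p, p + s.length, hinf.of_isConj hb.symm, hsup.of_isConj hb.symm,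
    (h.isInf_of_isNormalWord hΔ p hs).1, (h.isSup_of_isNormalWord hΔ p hs).1⟩

theorem isConj_decycling (hb : IsLNF S Δ b p s) : IsConj b (decycling S Δ b) := by
  refine isConj_iff.2 ⟨factor s s.length, ?_⟩
  rw [h.decycling_eq hb, hb.eq, prod_eq_seg_mul_factor s, tau_zpow_apply]
  group

theorem not_leftWeighted_of_not_isRigid (hb : IsLNF S Δ b p s) (hrigid : ¬ IsRigid S Δ b) :
    s ≠ [] ∧ ¬ LeftWeighted S ((τ Δ ^ p) (factor s s.length)) (factor s 1) := by
  simp only [IsRigid, not_forall] at hrigid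
  obtain ⟨q, t, ht, hne, hgcd⟩ := hrigid
  obtain ⟨rfl, rfl⟩ := h.isLNF_unique hb ht
  have hlen : 1 ≤ s.length := List.length_pos_of_ne_nil hne
  have hfirst := Submonoid.subset_closure (h.factor_mem_of_isLNF hb le_rfl hlen)
  have hlast := h.factor_mem_of_isLNF hb hlen le_rfl
  refine ⟨hne, fun hlw => hgcd ?_⟩
  rw [← h.leftWeighted_iff_isLeftGcd hlast (h.tau_zpow_pos (-p) hfirst)]
  simpa [tau_zpow_tau_zpow] using h.leftWeighted_tau_zpow (-p) hlw

end IsQuasiGarsideSystem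

/-! ### Decycling in spindle type -/

namespace IsQuasiGarsideSystem

variable (h : IsQuasiGarsideSystem S Δ) {a b z : G} {p : ℤ} {s : List G}
include h

theorem isLeftGcd_rightCompl_of_mul_eq {t c : G} (ht : t ∈ S) (hc : c ∈ S) (heq : t * a = Δ * c) :
    IsLeftGcd (pos S) a (rightCompl Δ t) (rightCompl Δ t) :=
  ⟨Submonoid.subset_closure (h.rightCompl_mem ht),
    ⟨c, Submonoid.subset_closure hc, eq_rightCompl_mul_of_mul_eq heq⟩, LeftDiv.refl _,
    fun _ _ _ hdt => hdt⟩

theorem decycling_eq_of_cons_append (hb : IsLNF S Δ b p (a :: (s ++ [z]))) :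
    decycling S Δ b = Δ ^ p * ((τ Δ ^ p) z * a) * s.prod := by
  rw [h.decycling_eq hb]
  simp [factor, seg, mul_assoc]

theorem isSummitInf_and_decycling_mem_SSS_of_singleton (hb : IsLNF S Δ b p [z]) :
    IsSummitInf S Δ b p ∧ decycling S Δ b ∈ SSS S Δ b := by
  have hΔ := hb.isInf.delta_ne_one
  have hz := h.isNormalWord_of_isLNF hb
  have heq : decycling S Δ b = Δ ^ p * ([z].map (τ Δ ^ p)).prod := by
    rw [h.decycling_eq hb]
    simp [factor, seg]
  refine ⟨hb.eq ▸ (h.isSummitInf_and_isSummitSup_of_isNormalWord hΔ hz (.inl rfl)).1, ?_⟩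
  rw [heq]
  exact h.mem_SSS_of_isNormalWord hΔ (h.isNormalWord_map_tau_zpow p hz) (.inl rfl)
    (heq ▸ h.isConj_decycling hb)

theorem isSummitInf_and_decycling_mem_SSS_of_replace_head {q : ℤ} {x : G}
    (hb : IsLNF S Δ b p (a :: (s ++ [z]))) (hx : IsNormalWord S Δ [x])
    (heq : Δ ^ p * ((τ Δ ^ p) z * a) = Δ ^ q * x)
    (hright : ∀ d, LeftWeighted S a d → LeftWeighted S x d)
    (hleft : ∀ w ∈ S, LeftWeighted S w z → LeftWeighted S ((τ Δ ^ q) w) x) :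
    IsSummitInf S Δ b q ∧ decycling S Δ b ∈ SSS S Δ b := by
  have hword := h.isNormalWord_of_isLNF hb
  obtain ⟨-, -, hjoin⟩ := List.isChain_append.1 (List.isChain_cons.1 hword.chain).2
  have hs : IsNormalWord S Δ s := hword.of_isInfix ⟨[a], [z], rfl⟩
  have hxs : IsNormalWord S Δ (x :: s) := hx.append hs fun w hw y hy => by
    obtain rfl := Option.mem_some_iff.1 hw
    refine hright y ((List.isChain_cons.1 hword.chain).1 y ?_)
    rw [List.head?_append, Option.mem_def.1 hy]
    rfl
  have hcyc : (x :: s).length = 1 ∨ IsCyclicallyNormalWord S Δ q (x :: s) := by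
    rcases s.eq_nil_or_concat' with rfl | ⟨u, w, rfl⟩
    · exact .inl rfl
    · refine .inr ⟨hxs, fun v hv y hy => ?_⟩
      obtain rfl := Option.mem_some_iff.1 hy
      rw [← List.cons_append, List.getLast?_concat, Option.mem_some_iff] at hv
      subst hv
      exact hleft w (hs.mem w (by simp)) (hjoin w (by simp) z rfl)
  have hd : decycling S Δ b = Δ ^ q * (x :: s).prod := by
    rw [h.decycling_eq_of_cons_append hb, heq, List.prod_cons, mul_assoc]
  have hconj := h.isConj_decycling hb
  rw [hd] at hconj ⊢
  have hΔ := hb.isInf.delta_ne_one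
  exact ⟨(h.isSummitInf_and_isSummitSup_of_isNormalWord hΔ hxs hcyc).1.of_isConj hconj.symm,
    h.mem_SSS_of_isNormalWord hΔ hxs hcyc hconj⟩

end IsQuasiGarsideSystem

namespace IsQuasiSpindleType

variable (h : IsQuasiSpindleType S Δ) {a b c d e t w z : G} {p : ℤ} {s : List G}
include h

theorem leftDiv_or_leftDiv_of_ne_one (ha : a ∈ S) (hb : b ∈ S) (he : e ∈ pos S) (he1 : e ≠ 1)
    (hea : LeftDiv (pos S) e a) (heb : LeftDiv (pos S) e b) :
    LeftDiv (pos S) a b ∨ LeftDiv (pos S) b a := by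
  have heS := h.mem_of_leftDiv he hea ha
  obtain ⟨x, hx, rfl⟩ := hea
  obtain ⟨y, hy, rfl⟩ := heb
  rw [leftDiv_mul_left_iff, leftDiv_mul_left_iff]
  rw [h.mul_mem_iff_leftDiv_rightCompl he hx] at ha
  rw [h.mul_mem_iff_leftDiv_rightCompl he hy] at hb
  exact h.leftDiv_total _ (h.rightCompl_mem heS) (rightCompl_eq_delta.not.2 he1) x hx y hy ha hb

theorem leftWeighted_of_leftDiv (hw : w ∈ pos S) (ht : t ∈ pos S) (ht1 : t ≠ 1) (ha : a ∈ S)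
    (haΔ : a ≠ Δ) (hta : LeftDiv (pos S) t a) (hwt : LeftWeighted S w t) : LeftWeighted S w a := by
  intro e he hwe hea
  rcases h.leftDiv_total a ha haΔ e he t ht hea hta with het | hte
  · exact hwt e he hwe het
  · have hwtS := h.mem_of_leftDiv ((pos S).mul_mem hw ht) (leftDiv_mul_left_iff.2 hte) hwe
    exact absurd (hwt t ht hwtS (LeftDiv.refl t)) ht1

theorem leftWeighted_of_mul (hb : b ∈ pos S) (hc : c ∈ pos S) (hc1 : c ≠ 1) (hbc : b * c ∈ S)
    (hbcΔ : b * c ≠ Δ) (hd : LeftWeighted S (b * c) d) : LeftWeighted S c d := by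
  intro e he hce hed
  have hcS := h.right_mem_of_mul_mem hb hc hbc
  have hcompl : LeftDiv (pos S) (rightCompl Δ (b * c)) (rightCompl Δ c) := by
    have hmem := Submonoid.subset_closure (h.rightCompl_mem hbc)
    rw [← h.mul_mem_iff_leftDiv_rightCompl hc hmem]
    refine h.right_mem_of_mul_mem hb ((pos S).mul_mem hc hmem) ?_
    rw [← mul_assoc, mul_rightCompl]
    exact h.delta_mem_simple
  rcases h.leftDiv_total _ (h.rightCompl_mem hcS) (rightCompl_eq_delta.not.2 hc1) e he _
    (Submonoid.subset_closure (h.rightCompl_mem hbc))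
    ((h.mul_mem_iff_leftDiv_rightCompl hc he).1 hce) hcompl with hle | hge
  · exact hd e he ((h.mul_mem_iff_leftDiv_rightCompl ((pos S).mul_mem hb hc) he).2 hle) hed
  · exact absurd (h.eq_delta_of_leftWeighted hbc hd (hge.trans hed)) hbcΔ

theorem mul_mem_or_exists_eq_delta_mul (ht : t ∈ S) (ha : a ∈ S) (hta : ¬ LeftWeighted S t a) :
    t * a ∈ S ∨ ∃ c ∈ S, t * a = Δ * c := by
  simp only [LeftWeighted, not_forall] at hta
  obtain ⟨e, he, hte, hea, he1⟩ := hta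
  have htP := Submonoid.subset_closure ht
  have haP := Submonoid.subset_closure ha
  rcases h.leftDiv_or_leftDiv_of_ne_one ha (h.rightCompl_mem ht) he he1 hea
    ((h.mul_mem_iff_leftDiv_rightCompl htP he).1 hte) with hle | ⟨c, hc, rfl⟩
  · exact .inl ((h.mul_mem_iff_leftDiv_rightCompl htP haP).2 hle)
  · have hcompl := Submonoid.subset_closure (h.rightCompl_mem ht)
    refine .inr ⟨c, h.right_mem_of_mul_mem hcompl hc ha, ?_⟩
    rw [← mul_assoc, mul_rightCompl]

theorem isSummitInf_and_decycling_mem_SSS_of_mul_mem (hb : IsLNF S Δ b p (a :: (s ++ [z])))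
    (hmem : (τ Δ ^ p) z * a ∈ S) (hne : (τ Δ ^ p) z * a ≠ Δ) :
    IsSummitInf S Δ b p ∧ decycling S Δ b ∈ SSS S Δ b := by
  have hword := h.isNormalWord_of_isLNF hb
  have ha := Submonoid.subset_closure (hword.mem a List.mem_cons_self)
  have hz := hword.mem z (by simp)
  have hτz1 : (τ Δ ^ p) z ≠ 1 := by simpa using hword.ne_one z (by simp)
  have hτz := h.tau_zpow_pos p (Submonoid.subset_closure hz)
  refine h.isSummitInf_and_decycling_mem_SSS_of_replace_head hb
    (.singleton hmem (fun h1 => hτz1 (h.eq_one_of_mul_eq_one hτz ha h1)) hne) rfl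
    (fun d had => h.leftWeighted_mul_left had hτz ha) fun w hw hwz => ?_
  exact h.leftWeighted_of_leftDiv (h.tau_zpow_pos p (Submonoid.subset_closure hw)) hτz hτz1 hmem hne
    (leftDiv_mul_right _ ha) (h.leftWeighted_tau_zpow p hwz)

theorem isSummitInf_and_decycling_mem_SSS_of_eq_delta_mul
    (hb : IsLNF S Δ b p (a :: (s ++ [z]))) (hc : c ∈ S) (hc1 : c ≠ 1)
    (heq : (τ Δ ^ p) z * a = Δ * c) :
    IsSummitInf S Δ b (p + 1) ∧ decycling S Δ b ∈ SSS S Δ b := by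
  have hword := h.isNormalWord_of_isLNF hb
  have ha := hword.mem a List.mem_cons_self
  have hz := hword.mem z (by simp)
  have hcz : LeftDiv (pos S) c ((τ Δ ^ (p + 1)) z) := by
    refine ⟨rightCompl Δ a, Submonoid.subset_closure (h.rightCompl_mem ha), ?_⟩
    rw [add_comm, ← tau_zpow_tau_zpow, tau_zpow_apply 1, rightCompl, eq_inv_mul_of_mul_eq heq.symm]
    group
  have hac := eq_rightCompl_mul_of_mul_eq heq
  have hcΔ : c ≠ Δ := by
    intro hcΔ
    rw [hcΔ] at hcz
    have hΔz := h.leftDiv_antisymm hcz (h.leftDiv_delta (h.tau_zpow_mem (p + 1) hz))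
    exact hword.ne_delta z (by simp)
      ((τ Δ ^ (p + 1)).injective (hΔz.symm.trans (tau_zpow_delta _).symm))
  refine h.isSummitInf_and_decycling_mem_SSS_of_replace_head hb (.singleton hc hc1 hcΔ)
    (by rw [heq, zpow_add_one, mul_assoc]) (fun d had => ?_)
    fun w _ hwz => (h.leftWeighted_tau_zpow (p + 1) hwz).mono_right hcz
  subst hac
  exact h.leftWeighted_of_mul (Submonoid.subset_closure (h.rightCompl_mem (h.tau_zpow_mem p hz)))
    (Submonoid.subset_closure hc) hc1 ha (hword.ne_delta _ List.mem_cons_self) had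

end IsQuasiSpindleType

/-- The word `s_{k+1}, …, s_{l-k}` obtained from `s_1, …, s_l` by removing `k` letters at both ends
(empty if `l ≤ 2 * k`). Its product is `seg s (k + 1) (l - k)`. -/
def trim {α : Type*} (s : List α) (k : ℕ) : List α := (s.take (s.length - k)).drop k

section Trim

variable {α : Type*}

theorem trim_zero (s : List α) : trim s 0 = s := by simp [trim]

theorem length_trim (s : List α) (k : ℕ) : (trim s k).length = s.length - k - k := by
  simp [trim]

theorem getElem?_trim (s : List α) (k i : ℕ) :
    (trim s k)[i]? = if i + 2 * k < s.length then s[i + k]? else none := by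
  rw [trim, List.getElem?_drop, List.getElem?_take, add_comm k]
  congr 1
  exact propext (by omega)

theorem trim_isInfix (s : List α) (k : ℕ) : trim s k <:+: s :=
  (List.drop_suffix _ _).isInfix.trans ⟨[], s.drop (s.length - k), List.take_append_drop _ _⟩

theorem trim_trim (s : List α) (j k : ℕ) : trim (trim s j) k = trim s (j + k) := by
  refine List.ext_getElem? fun i => ?_
  simp only [getElem?_trim, length_trim]
  grind

theorem trim_one_cons_append (a z : α) (s : List α) : trim (a :: (s ++ [z])) 1 = s := by
  simp [trim]

theorem factor_trim {s : List G} {j k : ℕ} (hj : 1 ≤ j) (hjk : j + 2 * k ≤ s.length) :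
    factor (trim s k) j = factor s (j + k) := by
  rw [factor, factor, List.getD_eq_getElem?_getD, List.getD_eq_getElem?_getD, getElem?_trim,
    if_pos (by omega), Nat.sub_add_comm hj]

end Trim

theorem factor_one_of_mem_head? {s : List G} {x : G} (hx : x ∈ s.head?) : factor s 1 = x := by
  rw [factor, List.getD_eq_getElem?_getD, ← List.head?_eq_getElem?, Option.mem_def.1 hx]
  rfl

theorem factor_length_of_mem_getLast? {s : List G} {x : G} (hx : x ∈ s.getLast?) :
    factor s s.length = x := by
  rw [factor, List.getD_eq_getElem?_getD, ← List.getLast?_eq_getElem?, Option.mem_def.1 hx]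
  rfl

theorem IsQuasiGarsideSystem.not_leftWeighted_of_lt_summitInf (h : IsQuasiGarsideSystem S Δ) {b : G}
    {p m : ℤ} {s : List G} (hb : IsLNF S Δ b p s) (hm : IsSummitInf S Δ b m) (hpm : p < m) :
    s ≠ [] ∧ ¬ LeftWeighted S ((τ Δ ^ p) (factor s s.length)) (factor s 1) := by
  have hword := h.isNormalWord_of_isLNF hb
  have hncyc : ¬ IsCyclicallyNormalWord S Δ p s := fun hcyc => by
    have hp := h.isSummitInf_of_isCyclicallyNormalWord hb.isInf.delta_ne_one hcyc
    rw [← hb.eq] at hp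
    exact hpm.ne (hp.unique hm)
  refine ⟨?_, fun hlw => hncyc ⟨hword, fun x hx y hy => ?_⟩⟩
  · rintro rfl
    exact hncyc ⟨hword, by simp⟩
  · rwa [factor_length_of_mem_getLast? hx, factor_one_of_mem_head? hy] at hlw

namespace IsQuasiSpindleType

variable (h : IsQuasiSpindleType S Δ) {b : G} {p m : ℤ} {s : List G}
include h

theorem decycling_mem_SSS_or_exists_eq_delta_mul (hb : IsLNF S Δ b p s) (hs : s ≠ [])
    (hlw : ¬ LeftWeighted S ((τ Δ ^ p) (factor s s.length)) (factor s 1)) :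
    (IsSummitInf S Δ b p ∧ decycling S Δ b ∈ SSS S Δ b) ∨
      (2 ≤ s.length ∧ ∃ c ∈ S, (τ Δ ^ p) (factor s s.length) * factor s 1 = Δ * c ∧
        decycling S Δ b = Δ ^ (p + 1) * c * (trim s 1).prod ∧
        (c ≠ 1 → IsSummitInf S Δ b (p + 1) ∧ decycling S Δ b ∈ SSS S Δ b)) := by
  have hword := h.isNormalWord_of_isLNF hb
  rcases s with _ | ⟨a, s⟩
  · exact absurd rfl hs
  rcases s.eq_nil_or_concat' with rfl | ⟨s, z, rfl⟩
  · exact .inl (h.isSummitInf_and_decycling_mem_SSS_of_singleton hb)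
  have hfirst : factor (a :: (s ++ [z])) 1 = a := rfl
  have hlast : factor (a :: (s ++ [z])) (a :: (s ++ [z])).length = z := by simp [factor]
  rw [hfirst, hlast] at hlw ⊢
  rw [trim_one_cons_append]
  have hlen : 2 ≤ (a :: (s ++ [z])).length := by simp
  have hd {c : G} (hc : (τ Δ ^ p) z * a = Δ * c) :
      decycling S Δ b = Δ ^ (p + 1) * c * s.prod := by
    rw [h.decycling_eq_of_cons_append hb, hc, zpow_add_one, mul_assoc (Δ ^ p) Δ c]
  rcases h.mul_mem_or_exists_eq_delta_mul (h.tau_zpow_mem p (hword.mem z (by simp)))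
    (hword.mem a List.mem_cons_self) hlw with hmem | ⟨c, hc, heq⟩
  · rcases eq_or_ne ((τ Δ ^ p) z * a) Δ with heq | hne
    · have heq1 : (τ Δ ^ p) z * a = Δ * 1 := by rw [heq, mul_one]
      exact .inr ⟨hlen, 1, h.one_mem, heq1, hd heq1, fun h1 => absurd rfl h1⟩
    · exact .inl (h.isSummitInf_and_decycling_mem_SSS_of_mul_mem hb hmem hne)
  · exact .inr ⟨hlen, c, hc, heq, hd heq, fun hc1 =>
      h.isSummitInf_and_decycling_mem_SSS_of_eq_delta_mul hb hc hc1 heq⟩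

theorem exists_decycling_eq_of_lt_summitInf (hb : IsLNF S Δ b p s) (hm : IsSummitInf S Δ b m)
    (hpm : p < m) :
    2 ≤ s.length ∧ ∃ c ∈ S, (τ Δ ^ p) (factor s s.length) * factor s 1 = Δ * c ∧
      decycling S Δ b = Δ ^ (p + 1) * c * (trim s 1).prod ∧ (p + 1 < m → c = 1) := by
  obtain ⟨hs, hlw⟩ := h.not_leftWeighted_of_lt_summitInf hb hm hpm
  rcases h.decycling_mem_SSS_or_exists_eq_delta_mul hb hs hlw with
    ⟨hp, -⟩ | ⟨hlen, c, hc, heq, hd, hsummit⟩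
  · exact absurd (hp.unique hm) hpm.ne
  · refine ⟨hlen, c, hc, heq, hd, fun hlt => ?_⟩
    by_contra hc1
    exact hlt.ne ((hsummit hc1).1.unique hm)

theorem isLNF_iterate_decycling (hb : IsLNF S Δ b p s) (hm : IsSummitInf S Δ b m) {k : ℕ}
    (hk : p + k < m) :
    IsLNF S Δ ((decycling S Δ)^[k] b) (p + k) (trim s k) ∧
      IsSummitInf S Δ ((decycling S Δ)^[k] b) m := by
  induction k with
  | zero => simpa [trim_zero] using ⟨hb, hm⟩
  | succ k ih =>
    obtain ⟨hbk, hmk⟩ := ih (by push_cast at hk; omega)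
    rw [Nat.cast_succ, ← add_assoc] at hk ⊢
    obtain ⟨-, c, -, -, hd, hc1⟩ := h.exists_decycling_eq_of_lt_summitInf hbk hmk (by omega)
    rw [hc1 hk, mul_one, trim_trim] at hd
    rw [Function.iterate_succ_apply']
    refine ⟨?_, hmk.of_isConj (h.isConj_decycling hbk)⟩
    rw [hd]
    exact h.isLNF_of_isNormalWord hb.isInf.delta_ne_one _
      ((h.isNormalWord_of_isLNF hb).of_isInfix (trim_isInfix s (k + 1)))

theorem exists_iterate_decycling_eq {k : ℕ} (hb : IsLNF S Δ b p s)
    (hm : IsSummitInf S Δ b (p + k + 1)) :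
    2 * (k + 1) ≤ s.length ∧ ∃ c ∈ S,
      (τ Δ ^ (p + k)) (factor s (s.length - k)) * factor s (k + 1) = Δ * c ∧
      (decycling S Δ)^[k + 1] b = Δ ^ (p + k + 1) * c * (trim s (k + 1)).prod := by
  obtain ⟨hbk, hmk⟩ := h.isLNF_iterate_decycling hb hm (k := k) (by omega)
  obtain ⟨hlen, c, hc, heq, hd, -⟩ := h.exists_decycling_eq_of_lt_summitInf hbk hmk (by omega)
  rw [length_trim] at hlen
  rw [length_trim, factor_trim (by omega) (by omega), factor_trim le_rfl (by omega),
    Nat.sub_add_cancel (by omega), add_comm 1] at heq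
  rw [trim_trim] at hd
  refine ⟨by omega, c, hc, heq, ?_⟩
  rw [Function.iterate_succ_apply', hd]

end IsQuasiSpindleType

end Garside

open Garside in
theorem mainTheorem7_general {G : Type*} [Group G] (S : Set G) (Δ : G)
    (hS : IsQuasiSpindleType S Δ) (b : G) (p : ℤ) (s : List G)
    (hb : IsLNF S Δ b p s) (hrigid : ¬ IsRigid S Δ b) :
    ((τ Δ ^ p) (factor s s.length) * factor s 1 ≠ Δ → decycling S Δ b ∈ SSS S Δ b) ∧
    (∀ p₀ : ℕ, IsSummitInf S Δ b (p + p₀) →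
      2 * p₀ ≤ s.length ∧
      (∀ k : ℕ, 1 ≤ k → k < p₀ →
        (decycling S Δ)^[k] b = Δ ^ (p + k) * seg s (k + 1) (s.length - k)) ∧
      (1 ≤ p₀ → ∃ s' ∈ S, ∃ s'' ∈ S,
        IsLeftGcd (pos S) (factor s p₀)
          ((τ Δ ^ (p + p₀ - 1)) (rightCompl Δ (factor s (s.length - p₀ + 1)))) s' ∧
        factor s p₀ = s' * s'' ∧
        (τ Δ ^ (p + p₀ - 1)) (factor s (s.length - p₀ + 1)) * factor s p₀ = Δ * s'' ∧
        (decycling S Δ)^[p₀] b =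
          Δ ^ (p + p₀) * s'' * seg s (p₀ + 1) (s.length - p₀))) := by
  refine ⟨fun hne => ?_, fun p₀ hp₀ => ⟨?_, fun k _ hk => ?_, fun h1 => ?_⟩⟩
  · obtain ⟨hs, hlw⟩ := hS.not_leftWeighted_of_not_isRigid hb hrigid
    rcases hS.decycling_mem_SSS_or_exists_eq_delta_mul hb hs hlw with
      ⟨-, hmem⟩ | ⟨-, c, -, heq, -, hmem⟩
    · exact hmem
    · exact (hmem fun hc => hne (by rw [heq, hc, mul_one])).2
  · cases p₀ with
    | zero => exact Nat.zero_le _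
    | succ k => exact (hS.exists_iterate_decycling_eq hb (by simpa [add_assoc] using hp₀)).1
  · exact (hS.isLNF_iterate_decycling hb hp₀ (by omega)).1.eq
  · obtain ⟨k, rfl⟩ := Nat.exists_eq_add_of_le' h1
    push_cast at hp₀ ⊢
    rw [← add_assoc] at hp₀ ⊢
    obtain ⟨hlen, c, hc, heq, hd⟩ := hS.exists_iterate_decycling_eq hb hp₀
    rw [add_sub_cancel_right, show s.length - (k + 1) + 1 = s.length - k by omega,
      tau_zpow_rightCompl]
    have ht := hS.tau_zpow_mem (p + k)
      (hS.factor_mem_of_isLNF hb (i := s.length - k) (by omega) (by omega))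
    exact ⟨_, hS.rightCompl_mem ht, c, hc, hS.isLeftGcd_rightCompl_of_mul_eq ht hc heq,
      eq_rightCompl_mul_of_mul_eq heq, heq, hd⟩

theorem mainTheorem7 {G : Type*} [Group G] (S : Set G) (Δ : G)
    (hS : Garside.IsSpindleType S Δ) (b : G) (p : ℤ) (s : List G)
    (hb : Garside.IsLNF S Δ b p s) (hrigid : ¬ Garside.IsRigid S Δ b) :
    ((Garside.τ Δ ^ p) (Garside.factor s s.length) * Garside.factor s 1 ≠ Δ →
      Garside.decycling S Δ b ∈ Garside.SSS S Δ b) ∧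
    (∀ p₀ : ℕ, Garside.IsSummitInf S Δ b (p + p₀) →
      2 * p₀ ≤ s.length ∧
      (∀ k : ℕ, 1 ≤ k → k < p₀ →
        (Garside.decycling S Δ)^[k] b =
          Δ ^ (p + k) * Garside.seg s (k + 1) (s.length - k)) ∧
      (1 ≤ p₀ → ∃ s' ∈ S, ∃ s'' ∈ S,
        Garside.IsLeftGcd (Garside.pos S) (Garside.factor s p₀)
          ((Garside.τ Δ ^ (p + p₀ - 1))
            (Garside.rightCompl Δ (Garside.factor s (s.length - p₀ + 1)))) s' ∧
        Garside.factor s p₀ = s' * s'' ∧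
        (Garside.τ Δ ^ (p + p₀ - 1)) (Garside.factor s (s.length - p₀ + 1)) *
          Garside.factor s p₀ = Δ * s'' ∧
        (Garside.decycling S Δ)^[p₀] b =
          Δ ^ (p + p₀) * s'' * Garside.seg s (p₀ + 1) (s.length - p₀))) :=
  mainTheorem7_general S Δ hS.isQuasiSpindleType b p s hb hrigid
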